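/- Let $N\ge 3$ and $2^*=2N/(N-2)$. Let $V:(0,\infty)\to[0,\infty]$ be a measurable function, finite almost everywhere, with $V\in L^1((r_1,r_2))$ for some $r_2>r_1>0$, and let $K:(0,\infty)\to(0,\infty)$ be a measurable function with $K\in L^s_{\mathrm{loc}}((0,\infty))$ for some $s>\frac{2N}{N+2}$. Let $$D^{1,2}(\mathbb R^N)=\{u\in L^{2^*}(\mathbb R^N):\nabla u\in L^2(\mathbb R^N)\},\qquad H^1_V=\Big\{u\in D^{1,2}(\mathbb R^N):\int_{\mathbb R^N}V(|x|)u^2\,dx<\infty\Big\},$$ with the norm $\|u\|^2=\int_{\mathbb R^N}(|\nabla u|^2+V(|x|)u^2)\,dx$, and let $H^1_{V,\mathrm r}$ be the closure in $H^1_V$ of the set of all radial $\varphi\in C^\infty_{\mathrm c}(\mathbb R^N)$ with $\int_{\mathbb R^N} V(|x|)\varphi^2\,dx<\infty$. For $q>1$ and $R>0$ put, with $B_R=\{x\in\mathbb R^N:|x|<R\}$, $$\mathcal R_0(q,R)=\sup\Big\{\int_{B_R}K(|x|)\,|u|^{q-1}|h|\,dx:\ u\in H^1_{V,\mathrm r},\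 h\in H^1_V,\ \|u\|=\|h\|=1\Big\}\in[0,\infty].$$ For $\alpha\in\mathbb R$, $\beta\le1$, $\gamma\ge2$ put $$q_*=2\,\frac{\alpha-\gamma\beta+N}{N-\gamma}\quad(\gamma\ne N),\qquad q_{**}=2\,\frac{2\alpha+(1-2\beta)\gamma+2(N-1)}{2(N-1)-\gamma}\quad(\gamma\neq 2N-2),$$ and let $\mathcal A_{\beta,\gamma}$ be the set of all $(\alpha,q)\in\mathbb R^2$ such that - $\max\{1,2\beta\}<q<\min\{q_*,q_{**}\}$, if $2\le\gamma<N$; - $\max\{1,2\beta\}<q<q_{**}$ and $\alpha>-(1-\beta)N$, if $\gamma=N$; - $\max\{1,2\beta,q_*\}<q<q_{**}$, if $N<\gamma<2N-2$; - $\max\{1,2\beta,q_*\}<q$ and $\alpha>-(1-\beta)\gamma$, if $\gamma=2N-2$; - $\max\{1,2\beta,q_*,q_{**}\}<q$, if $\gamma>2N-2$. Assume that there is $R_1>0$ such that $$\operatorname*{ess\,sup}_{r\in(0,R_1)}\frac{K(r)}{r^{\alpha_0}V(r)^{\beta_0}}<+\infty\quad\text{for some }0\le\beta_0\le1\text{ and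 }\alpha_0\in\mathbb R,$$ where $V(r)^0=1$ for every $r$, and $$\operatorname*{ess\,inf}_{r\in(0,R_1)}r^{\gamma_0}V(r)>0\quad\text{for some }\gamma_0\ge2.$$ Then $\displaystyle\lim_{R\to0^+}\mathcal R_0(q_1,R)=0$ for every $q_1\in\mathbb R$ such that $(\alpha_0,q_1)\in\mathcal A_{\beta_0,\gamma_0}$. -/

import Mathlib

open MeasureTheory Set Filter Topology
open scoped ENNReal NNReal ContDiff

noncomputable section

namespace RadialSobolev

/-- The Euclidean space `ℝ^N`. -/
abbrev Space (N : ℕ) := EuclideanSpace ℝ (Fin N)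

/-- Assumption `(V)` on a potential `V : (0,∞) → [0,∞]` (only the values on `(0,∞)` matter):
it is Lebesgue measurable, and integrable on some interval `(r₁, r₂)` with `r₂ > r₁ > 0`. -/
def AssumptionV (V : ℝ → ℝ≥0∞) : Prop :=
  AEMeasurable V (volume.restrict (Ioi 0)) ∧
    ∃ r₁ r₂ : ℝ, 0 < r₁ ∧ r₁ < r₂ ∧ ∫⁻ r in Ioo r₁ r₂, V r < ⊤

/-- Assumption `(K)` on a potential `K : (0,∞) → (0,∞)` (only the values on `(0,∞)` matter):
it is Lebesgue measurable, positive, and belongs to `L^s_loc((0,∞))` for some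
`s > 2N/(N+2)`. -/
def AssumptionK (N : ℕ) (K : ℝ → ℝ) : Prop :=
  AEMeasurable K (volume.restrict (Ioi 0)) ∧ (∀ r : ℝ, 0 < r → 0 < K r) ∧
    ∃ s : ℝ, 2 * (N : ℝ) / ((N : ℝ) + 2) < s ∧
      ∀ C : Set ℝ, C ⊆ Ioi 0 → IsCompact C → MemLp K (ENNReal.ofReal s) (volume.restrict C)

/-- `g` is the weak (distributional) gradient of `u` on `ℝ^N`. -/
def IsWeakGradient {N : ℕ} (u : Space N → ℝ) (g : Space N → Space N) : Prop :=
  LocallyIntegrable u ∧ LocallyIntegrable g ∧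
    ∀ φ : Space N → ℝ, ContDiff ℝ ∞ φ → HasCompactSupport φ → ∀ v : Space N,
      ∫ x, u x * fderiv ℝ φ x v = - ∫ x, φ x * inner ℝ (g x) v

open Classical in
/-- A version of the weak gradient of `u`, which is unique up to a null set when it exists
(the value is `0` if `u` has no weak gradient). -/
def weakGradient {N : ℕ} (u : Space N → ℝ) : Space N → Space N :=
  if h : ∃ g, IsWeakGradient u g then h.choose else 0

/-- The space `D^{1,2}(ℝ^N) = {u ∈ L^{2*} : ∇u ∈ L²}`, with `2* = 2N/(N-2)`. -/
def D12 (N : ℕ) : Set (Space N → ℝ) :=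
  {u | MemLp u (ENNReal.ofReal (2 * (N : ℝ) / ((N : ℝ) - 2))) ∧
    ∃ g, IsWeakGradient u g ∧ MemLp g 2}

/-- The space `H¹_V` of all `u ∈ D^{1,2}(ℝ^N)` such that `∫ V(|x|) u² dx < ∞`. -/
def HV {N : ℕ} (V : ℝ → ℝ≥0∞) : Set (Space N → ℝ) :=
  {u | u ∈ D12 N ∧ ∫⁻ x, V ‖x‖ * ‖u x‖ₑ ^ 2 < ⊤}

/-- The norm `‖u‖ = (∫ (|∇u|² + V(|x|) u²) dx)^{1/2}` of `H¹_V`, as an extended number. -/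
def normHV {N : ℕ} (V : ℝ → ℝ≥0∞) (u : Space N → ℝ) : ℝ≥0∞ :=
  (∫⁻ x, (‖weakGradient u x‖ₑ ^ 2 + V ‖x‖ * ‖u x‖ₑ ^ 2)) ^ (1 / 2 : ℝ)

/-- `C^∞_{c,rad}(ℝ^N)`: smooth radial functions with compact support. -/
def SmoothCompactRadial (N : ℕ) : Set (Space N → ℝ) :=
  {φ | ContDiff ℝ ∞ φ ∧ HasCompactSupport φ ∧ ∀ x y : Space N, ‖x‖ = ‖y‖ → φ x = φ y}

/-- The radial space `H¹_{V,r}`: the closure, in `H¹_V` with its norm, of the set of all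
`φ ∈ C^∞_{c,rad}(ℝ^N)` such that `∫ V(|x|) φ² dx < ∞`. -/
def HVrad {N : ℕ} (V : ℝ → ℝ≥0∞) : Set (Space N → ℝ) :=
  {u | u ∈ HV V ∧ ∀ ε : ℝ≥0∞, 0 < ε →
    ∃ φ ∈ SmoothCompactRadial N, ∫⁻ x, V ‖x‖ * ‖φ x‖ₑ ^ 2 < ⊤ ∧ normHV V (u - φ) < ε}

/-- `R₀(q,R)`: the supremum of `∫_{B_R} K(|x|) |u|^{q-1} |h| dx` over `u ∈ H¹_{V,r}` and
`h ∈ H¹_V` with `‖u‖ = ‖h‖ = 1`; it may be infinite. -/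
def R0 (N : ℕ) (V : ℝ → ℝ≥0∞) (K : ℝ → ℝ) (q R : ℝ) : ℝ≥0∞ :=
  ⨆ (u : Space N → ℝ) (h : Space N → ℝ) (_ : u ∈ HVrad V) (_ : h ∈ HV V)
    (_ : normHV V u = 1) (_ : normHV V h = 1),
    ∫⁻ x in Metric.ball (0 : Space N) R, ENNReal.ofReal (K ‖x‖) * ‖u x‖ₑ ^ (q - 1) * ‖h x‖ₑ

/-- `q_*(α,β,γ)`, meaningful for `γ ≠ N`. -/
def qStar (N : ℕ) (α β γ : ℝ) : ℝ := 2 * ((α - γ * β + N) / (N - γ))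

/-- `q_{**}(α,β,γ)`, meaningful for `γ ≠ 2N-2`. -/
def qStarStar (N : ℕ) (α β γ : ℝ) : ℝ :=
  2 * ((2 * α + (1 - 2 * β) * γ + 2 * ((N : ℝ) - 1)) / (2 * ((N : ℝ) - 1) - γ))

/-- The region `A_{β,γ}` of the `αq`-plane, for `β ≤ 1` and `γ ≥ 2`; the five branches are
`2 ≤ γ < N`, `γ = N`, `N < γ < 2N-2`, `γ = 2N-2` and `γ > 2N-2`. -/
def region (N : ℕ) (β γ : ℝ) : Set (ℝ × ℝ) :=
  {p | if γ < N then
        max 1 (2 * β) < p.2 ∧ p.2 < min (qStar N p.1 β γ) (qStarStar N p.1 β γ)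
      else if γ = N then
        max 1 (2 * β) < p.2 ∧ p.2 < qStarStar N p.1 β γ ∧ -(1 - β) * N < p.1
      else if γ < 2 * (N : ℝ) - 2 then
        max (max 1 (2 * β)) (qStar N p.1 β γ) < p.2 ∧ p.2 < qStarStar N p.1 β γ
      else if γ = 2 * (N : ℝ) - 2 then
        max (max 1 (2 * β)) (qStar N p.1 β γ) < p.2 ∧ -(1 - β) * γ < p.1
      else
        max (max (max 1 (2 * β)) (qStar N p.1 β γ)) (qStarStar N p.1 β γ) < p.2}

end RadialSobolev

end

/-!
Where `V(r) ≥ c r^{-γ₀}`, the bound `K ≤ S r^{α₀} V^{β₀}` self-improves to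
`K ≤ S' r^{α₀ + γ₀ (θ - β₀)} V^θ` for every `θ ≥ β₀`, and `q₁` dictates how much of `V` to spend.

If `q₁ < 2`, take `θ = q₁ / 2` and apply Hölder's inequality with the exponents `(q₁ - 1) / 2`,
`1 / 2` and `(2 - q₁) / 2` to the factors `V u²`, `V h²` and a power of `|x|`; the inequality
`q₁ (N - γ₀) < 2 (α₀ - γ₀ β₀ + N)` says exactly that this power is integrable at the origin.

If `q₁ ≥ 2`, take `θ = 1`. For a radial function,
`r^{N - 1 - γ₀ / 2} u(r)²` has derivative at most a multiple of
`r^{N - 1} (u'(r)² + r^{-γ₀} u(r)²)`, whence `|u(x)| ≤ C ‖u‖ |x|^{-(2 (N - 1) - γ₀) / 4}` near the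
origin; this passes from smooth functions to their closure because `V > 0` there. The surplus
`|u|^{q₁ - 2}` is absorbed by this decay, and the Cauchy–Schwarz inequality for `V |u| |h|` leaves
a power of `R`, whose exponent is positive because of the condition on `q_{**}`.
-/

namespace RadialSobolev

section Polar

variable {E : Type*} [NormedAddCommGroup E] [NormedSpace ℝ E] [FiniteDimensional ℝ E]
  [Nontrivial E] [MeasurableSpace E] [BorelSpace E] (μ : Measure E) [μ.IsAddHaarMeasure]

theorem lintegral_fun_norm_addHaar {f : ℝ → ℝ≥0∞} (hf : Measurable f) :
    ∫⁻ x, f ‖x‖ ∂μ = Module.finrank ℝ E * μ (Metric.ball 0 1) *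
      ∫⁻ r in Ioi 0, ENNReal.ofReal (r ^ (Module.finrank ℝ E - 1)) * f r := by
  have hsnd : Measurable fun r : Ioi (0 : ℝ) => f r := hf.comp measurable_subtype_coe
  calc ∫⁻ x, f ‖x‖ ∂μ
      = ∫⁻ x : ({0}ᶜ : Set E), f ‖(x : E)‖ ∂μ.comap (↑) := by
        rw [lintegral_subtype_comap (measurableSet_singleton _).compl fun x => f ‖x‖,
          restrict_compl_singleton]
    _ = ∫⁻ x, f x.2 ∂μ.toSphere.prod (.volumeIoiPow (Module.finrank ℝ E - 1)) := by
        simpa using μ.measurePreserving_homeomorphUnitSphereProd.lintegral_comp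
          (hsnd.comp measurable_snd)
    _ = μ.toSphere univ * ∫⁻ r : Ioi (0 : ℝ), f r ∂.volumeIoiPow (Module.finrank ℝ E - 1) := by
        simpa [mul_comm] using lintegral_prod_mul (μ := μ.toSphere) aemeasurable_const
          hsnd.aemeasurable (f := fun _ => 1)
    _ = _ := by
        rw [μ.toSphere_apply_univ, Measure.volumeIoiPow, lintegral_withDensity_eq_lintegral_mul _
          (measurable_subtype_coe.pow_const _).ennreal_ofReal hsnd]
        exact congrArg _ (lintegral_subtype_comap measurableSet_Ioi
          fun r => ENNReal.ofReal (r ^ (Module.finrank ℝ E - 1)) * f r)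

theorem setLIntegral_ball_fun_norm_addHaar {f : ℝ → ℝ≥0∞} (hf : Measurable f) (ρ : ℝ) :
    ∫⁻ x in Metric.ball 0 ρ, f ‖x‖ ∂μ = Module.finrank ℝ E * μ (Metric.ball 0 1) *
      ∫⁻ r in Ioo 0 ρ, ENNReal.ofReal (r ^ (Module.finrank ℝ E - 1)) * f r := by
  have hball : (Metric.ball (0 : E) ρ).indicator (fun x => f ‖x‖) =
      fun x => (Iio ρ).indicator f ‖x‖ := by
    ext x
    simp [indicator]
  rw [← lintegral_indicator measurableSet_ball, hball,
    lintegral_fun_norm_addHaar μ (hf.indicator measurableSet_Iio), ← Ioi_inter_Iio, inter_comm,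
    ← Measure.restrict_restrict measurableSet_Iio, ← lintegral_indicator measurableSet_Iio]
  simp only [indicator_mul_right]

theorem quasiMeasurePreserving_norm :
    Measure.QuasiMeasurePreserving (fun x : E => ‖x‖) μ (volume.restrict (Ioi 0)) := by
  refine ⟨measurable_norm, Measure.AbsolutelyContinuous.mk fun Z hZ hZ0 => ?_⟩
  have hweight : (fun r : ℝ => ENNReal.ofReal (r ^ (Module.finrank ℝ E - 1)) *
      Z.indicator 1 r) =ᵐ[volume.restrict (Ioi 0)] 0 := by
    filter_upwards [measure_eq_zero_iff_ae_notMem.1 hZ0] with r hr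
    simp [hr]
  rw [Measure.map_apply measurable_norm hZ, ← lintegral_indicator_one (measurable_norm hZ)]
  change ∫⁻ x, Z.indicator 1 ‖x‖ ∂μ = 0
  rw [lintegral_fun_norm_addHaar μ (measurable_one.indicator hZ), lintegral_congr_ae hweight]
  simp

theorem ae_restrict_ball_of_ae_restrict_Ioo {p : ℝ → Prop} {R : ℝ}
    (hp : ∀ᵐ r ∂volume.restrict (Ioo 0 R), p r) :
    ∀ᵐ x ∂μ.restrict (Metric.ball 0 R), p ‖x‖ := by
  rw [← Ioi_inter_Iio, inter_comm, ← Measure.restrict_restrict measurableSet_Iio,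
    ae_restrict_iff' measurableSet_Iio] at hp
  rw [ae_restrict_iff' measurableSet_ball]
  filter_upwards [(quasiMeasurePreserving_norm μ).ae hp] with x hx hxR
  exact hx (by simpa using hxR)

theorem ae_restrict_ball_ne_zero_norm_lt (R : ℝ) :
    ∀ᵐ x ∂μ.restrict (Metric.ball 0 R), x ≠ 0 ∧ ‖x‖ < R := by
  filter_upwards [ae_restrict_of_ae (μ.ae_ne 0), ae_restrict_mem measurableSet_ball] with x hx hxR
  exact ⟨hx, by simpa using hxR⟩

theorem setLIntegral_Ioo_rpow {s R : ℝ} (hs : -1 < s) (hR : 0 < R) :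
    ∫⁻ r in Ioo 0 R, ENNReal.ofReal (r ^ s) = ENNReal.ofReal (R ^ (s + 1) / (s + 1)) := by
  have hint : IntegrableOn (fun r : ℝ => r ^ s) (Ioo 0 R) :=
    (intervalIntegral.integrableOn_Ioo_rpow_iff hR).2 hs
  have hnonneg : 0 ≤ᵐ[volume.restrict (Ioo 0 R)] fun r : ℝ => r ^ s := by
    filter_upwards [ae_restrict_mem measurableSet_Ioo] with r hr
    exact Real.rpow_nonneg hr.1.le _
  rw [← ofReal_integral_eq_lintegral_ofReal hint hnonneg, ← integral_Ioc_eq_integral_Ioo,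
    ← intervalIntegral.integral_of_le hR.le, integral_rpow (Or.inl hs),
    Real.zero_rpow (by linarith), sub_zero]

theorem setLIntegral_ball_rpow_norm {d R : ℝ} (hd : -(Module.finrank ℝ E : ℝ) < d) (hR : 0 < R) :
    ∫⁻ x in Metric.ball 0 R, ENNReal.ofReal (‖x‖ ^ d) ∂μ =
      Module.finrank ℝ E * μ (Metric.ball 0 1) *
        ENNReal.ofReal (R ^ (Module.finrank ℝ E + d) / (Module.finrank ℝ E + d)) := by
  have hexp : ∀ r ∈ Ioo (0 : ℝ) R, ENNReal.ofReal (r ^ (Module.finrank ℝ E - 1)) *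
      ENNReal.ofReal (r ^ d) = ENNReal.ofReal (r ^ (Module.finrank ℝ E + d - 1)) := by
    intro r hr
    have := hr.1
    rw [← ENNReal.ofReal_mul (by positivity), ← Real.rpow_natCast, ← Real.rpow_add hr.1,
      Nat.cast_pred Module.finrank_pos]
    ring_nf
  rw [setLIntegral_ball_fun_norm_addHaar μ (f := fun r => ENNReal.ofReal (r ^ d)) (by fun_prop),
    setLIntegral_congr_fun measurableSet_Ioo hexp, setLIntegral_Ioo_rpow (by linarith) hR,
    sub_add_cancel]

theorem tendsto_setLIntegral_ball_rpow_norm {d : ℝ} (hd : -(Module.finrank ℝ E : ℝ) < d) :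
    Tendsto (fun R : ℝ => ∫⁻ x in Metric.ball 0 R, ENNReal.ofReal (‖x‖ ^ d) ∂μ)
      (𝓝[>] 0) (𝓝 0) := by
  have hpos : 0 < Module.finrank ℝ E + d := by linarith
  have hpow : Tendsto (fun R : ℝ => R ^ (Module.finrank ℝ E + d) / (Module.finrank ℝ E + d))
      (𝓝[>] 0) (𝓝 0) := by
    have := ((Real.continuousAt_rpow_const 0 _ (Or.inr hpos.le)).tendsto.div_const
      (Module.finrank ℝ E + d)).mono_left (nhdsWithin_le_nhds (s := Ioi 0))
    simpa only [Real.zero_rpow hpos.ne', zero_div] using this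
  have hlim := ENNReal.Tendsto.const_mul (ENNReal.tendsto_ofReal hpow) (Or.inr
    (ENNReal.mul_ne_top (ENNReal.natCast_ne_top (Module.finrank ℝ E))
      (measure_ball_lt_top (μ := μ) (x := 0) (r := 1)).ne))
  rw [ENNReal.ofReal_zero, mul_zero] at hlim
  refine hlim.congr' ?_
  filter_upwards [self_mem_nhdsWithin] with R hR
  exact (setLIntegral_ball_rpow_norm μ hd hR).symm

end Polar

section Trace

theorem ofReal_sub_mul_le_setLIntegral {g g' D : ℝ → ℝ} {a b : ℝ} (hab : a ≤ b)
    (hg : ∀ s ∈ Icc a b, HasDerivAt g (g' s) s) (hD : Measurable D)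
    (hgD : ∀ s ∈ Ioo a b, |g s| + (b - a) * |g' s| ≤ D s) :
    ENNReal.ofReal ((b - a) * g a) ≤ ∫⁻ s in Ioo a b, ENNReal.ofReal (D s) := by
  rcases eq_or_ne (∫⁻ s in Ioo a b, ENNReal.ofReal (D s)) ⊤ with htop | hfin
  · simp [htop]
  have hDnn : 0 ≤ᵐ[volume.restrict (Ioo a b)] D := by
    filter_upwards [ae_restrict_mem measurableSet_Ioo] with s hs
    have := sub_nonneg.2 hab
    exact le_trans (by positivity) (hgD s hs)
  have hint : IntegrableOn D (Ioo a b) :=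
    (lintegral_ofReal_ne_top_iff_integrable hD.aestronglyMeasurable hDnn).1 hfin
  have hprim : ∀ s ∈ Icc a b, HasDerivAt (fun s => -((b - s) * g s))
      (-(-1 * g s + (b - s) * g' s)) s := fun s hs =>
    (((hasDerivAt_id s).const_sub b).mul (hg s hs)).neg
  have hle := intervalIntegral.sub_le_integral_of_hasDeriv_right_of_le hab
    (fun s hs => (hprim s hs).continuousAt.continuousWithinAt)
    (fun s hs => (hprim s (Ioo_subset_Icc_self hs)).hasDerivWithinAt)
    ((integrableOn_Icc_iff_integrableOn_Ioo).2 hint) fun s hs => ?_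
  · rw [← ofReal_integral_eq_lintegral_ofReal hint hDnn, ← integral_Ioc_eq_integral_Ioo,
      ← intervalIntegral.integral_of_le hab]
    exact ENNReal.ofReal_le_ofReal (by simpa using hle)
  · have : -((b - s) * g' s) ≤ (b - a) * |g' s| :=
      calc -((b - s) * g' s) = (b - s) * -g' s := by ring
        _ ≤ (b - s) * |g' s| := mul_le_mul_of_nonneg_left (neg_le_abs _) (by linarith [hs.2])
        _ ≤ (b - a) * |g' s| := mul_le_mul_of_nonneg_right (by linarith [hs.1]) (abs_nonneg _)
    linarith [hgD s hs, le_abs_self (g s)]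

theorem abs_rpow_mul_sq_add_abs_deriv_le {s γ : ℝ} (hs : 0 < s) (hs1 : s ≤ 1) (hγ : 2 ≤ γ)
    (ν x y : ℝ) :
    |s ^ (ν - γ / 2) * x ^ 2| +
        |(ν - γ / 2) * s ^ (ν - γ / 2 - 1) * x ^ 2 + s ^ (ν - γ / 2) * (2 * x * y)| ≤
      (|ν - γ / 2| + 2) * (s ^ ν * (y ^ 2 + s ^ (-γ) * x ^ 2)) := by
  -- In terms of `t = s ^ (-γ / 2)`, the inequality follows from `1 ≤ s⁻¹ ≤ t` and
  -- `2 t |x y| ≤ y² + t² x²`.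
  set t : ℝ := s ^ (-γ / 2)
  have hσ : s ^ (ν - γ / 2) = s ^ ν * t := by rw [← Real.rpow_add hs]; ring_nf
  have hσ1 : s ^ (ν - γ / 2 - 1) = s ^ ν * t * s⁻¹ := by rw [Real.rpow_sub_one hs.ne', hσ]; rfl
  have hγt : s ^ (-γ) = t ^ 2 := by rw [sq, ← Real.rpow_add hs]; ring_nf
  have hst : s⁻¹ ≤ t := by
    rw [← Real.rpow_neg_one]
    exact Real.rpow_le_rpow_of_exponent_ge hs hs1 (by linarith)
  have ht : 1 ≤ t := ((one_le_inv₀ hs).2 hs1).trans hst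
  have hbase : t * x ^ 2 + |(ν - γ / 2) * (t * s⁻¹) * x ^ 2 + t * (2 * x * y)| ≤
      (|ν - γ / 2| + 2) * (y ^ 2 + t ^ 2 * x ^ 2) := by
    have hcross : |t * (2 * x * y)| ≤ y ^ 2 + t ^ 2 * x ^ 2 :=
      abs_le.2 ⟨by nlinarith [sq_nonneg (y + t * x)], by nlinarith [sq_nonneg (y - t * x)]⟩
    have hpot : t * s⁻¹ * x ^ 2 ≤ t ^ 2 * x ^ 2 := by rw [sq t]; gcongr
    have hzero : t * x ^ 2 ≤ t ^ 2 * x ^ 2 := by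
      gcongr
      exact le_self_pow₀ ht two_ne_zero
    have habs : |(ν - γ / 2) * (t * s⁻¹) * x ^ 2| = |ν - γ / 2| * (t * s⁻¹ * x ^ 2) := by
      rw [mul_assoc, abs_mul, abs_of_nonneg (a := t * s⁻¹ * x ^ 2) (by positivity)]
    have hsum := abs_add_le ((ν - γ / 2) * (t * s⁻¹) * x ^ 2) (t * (2 * x * y))
    have hσpot := mul_le_mul_of_nonneg_left
      (hpot.trans (le_add_of_nonneg_left (sq_nonneg y))) (abs_nonneg (ν - γ / 2))
    linarith [sq_nonneg y]
  rw [hσ, hσ1, hγt, abs_of_nonneg (by positivity)]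
  calc s ^ ν * t * x ^ 2 +
        |(ν - γ / 2) * (s ^ ν * t * s⁻¹) * x ^ 2 + s ^ ν * t * (2 * x * y)|
      = s ^ ν * (t * x ^ 2 + |(ν - γ / 2) * (t * s⁻¹) * x ^ 2 + t * (2 * x * y)|) := by
        have hfactor : (ν - γ / 2) * (s ^ ν * t * s⁻¹) * x ^ 2 + s ^ ν * t * (2 * x * y) =
            s ^ ν * ((ν - γ / 2) * (t * s⁻¹) * x ^ 2 + t * (2 * x * y)) := by ring
        rw [hfactor, abs_mul, abs_of_nonneg (Real.rpow_nonneg hs.le ν)]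
        ring
    _ ≤ s ^ ν * ((|ν - γ / 2| + 2) * (y ^ 2 + t ^ 2 * x ^ 2)) := by gcongr
    _ = _ := by ring

theorem ofReal_rpow_mul_sq_le_setLIntegral {f : ℝ → ℝ} (hf : Differentiable ℝ f) {ν γ ρ r : ℝ}
    (hγ : 2 ≤ γ) (hρ : ρ ≤ 1) (hr : 0 < r) (hrρ : r < ρ / 2) :
    ENNReal.ofReal (r ^ (ν - γ / 2) * f r ^ 2) ≤ ENNReal.ofReal (2 / ρ * (|ν - γ / 2| + 2)) *
      ∫⁻ s in Ioo 0 ρ, ENNReal.ofReal (s ^ ν * (deriv f s ^ 2 + s ^ (-γ) * f s ^ 2)) := by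
  have hfm : Measurable f := hf.continuous.measurable
  have htrace := ofReal_sub_mul_le_setLIntegral (a := r) (b := ρ) (by linarith)
    (g := fun s => s ^ (ν - γ / 2) * f s ^ 2)
    (D := fun s => (|ν - γ / 2| + 2) * (s ^ ν * (deriv f s ^ 2 + s ^ (-γ) * f s ^ 2)))
    (fun s hs => (Real.hasDerivAt_rpow_const (Or.inl (hr.trans_le hs.1).ne')).mul
      ((hf s).hasDerivAt.fun_pow 2)) (by fun_prop) fun s hs => ?_
  · calc ENNReal.ofReal (r ^ (ν - γ / 2) * f r ^ 2)
        ≤ ENNReal.ofReal (2 / ρ * ((ρ - r) * (r ^ (ν - γ / 2) * f r ^ 2))) := by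
          have : 1 ≤ 2 / ρ * (ρ - r) := by
            rw [div_mul_eq_mul_div, one_le_div (by linarith)]
            linarith
          rw [← mul_assoc]
          exact ENNReal.ofReal_le_ofReal (le_mul_of_one_le_left (by positivity) this)
      _ ≤ ENNReal.ofReal (2 / ρ) * (ENNReal.ofReal (|ν - γ / 2| + 2) *
          ∫⁻ s in Ioo 0 ρ, ENNReal.ofReal (s ^ ν * (deriv f s ^ 2 + s ^ (-γ) * f s ^ 2))) := by
          rw [ENNReal.ofReal_mul (div_pos two_pos (by linarith)).le,
            ← lintegral_const_mul' _ _ ENNReal.ofReal_ne_top]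
          simp only [← ENNReal.ofReal_mul (show 0 ≤ |ν - γ / 2| + 2 by positivity)]
          gcongr
          exact htrace.trans (lintegral_mono_set (Ioo_subset_Ioo_left hr.le))
      _ = _ := by rw [ENNReal.ofReal_mul (div_pos two_pos (by linarith)).le, mul_assoc]
  · have hs0 : 0 < s := hr.trans hs.1
    refine le_trans ?_ (abs_rpow_mul_sq_add_abs_deriv_le hs0 (hs.2.le.trans hρ) hγ ν _ _)
    gcongr
    refine (mul_le_of_le_one_left (abs_nonneg _) (by linarith)).trans_eq ?_
    norm_num [mul_assoc]

end Trace

/-- The exponent of the pointwise bound `|u(x)| ≤ C |x| ^ (-decayExponent d γ)` near the origin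
satisfied by radial functions on a `d`-dimensional space whose energy
`∫ |∇u|² + |x| ^ (-γ) u²` is finite. -/
noncomputable def decayExponent (d : ℕ) (γ : ℝ) : ℝ := (2 * ((d : ℝ) - 1) - γ) / 4

section Radial

variable {E : Type*} [NormedAddCommGroup E] [NormedSpace ℝ E] {φ : E → ℝ}

theorem apply_norm_smul_of_radial (hrad : ∀ x y, ‖x‖ = ‖y‖ → φ x = φ y) {e : E} (he : ‖e‖ = 1)
    (y : E) : φ (‖y‖ • e) = φ y :=
  hrad _ _ (by simp [norm_smul, he])

theorem abs_deriv_norm_le_norm_fderiv_of_radial (hφ : Differentiable ℝ φ)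
    (hrad : ∀ x y, ‖x‖ = ‖y‖ → φ x = φ y) {e : E} (he : ‖e‖ = 1) {y : E} (hy : y ≠ 0) :
    |deriv (fun r : ℝ => φ (r • e)) ‖y‖| ≤ ‖fderiv ℝ φ y‖ := by
  have hprofile : (fun r : ℝ => φ (r • e)) = fun r => φ (r • (‖y‖⁻¹ • y)) := by
    ext r
    exact hrad _ _ (by simp [norm_smul, hy, he])
  have hline : HasDerivAt (fun r : ℝ => r • (‖y‖⁻¹ • y)) (‖y‖⁻¹ • y) ‖y‖ := by
    simpa using (hasDerivAt_id ‖y‖).smul_const (‖y‖⁻¹ • y)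
  have hφy : HasFDerivAt φ (fderiv ℝ φ y) (‖y‖ • (‖y‖⁻¹ • y)) := by
    rw [smul_inv_smul₀ (norm_ne_zero_iff.2 hy)]
    exact (hφ y).hasFDerivAt
  have hderiv := (hφy.comp_hasDerivAt _ hline).deriv
  rw [Function.comp_def] at hderiv
  rw [hprofile, hderiv, ← Real.norm_eq_abs]
  exact ((fderiv ℝ φ y).le_opNorm _).trans_eq (by simp [norm_smul, hy])

variable [FiniteDimensional ℝ E] [Nontrivial E] [MeasurableSpace E] [BorelSpace E]
  (μ : Measure E) [μ.IsAddHaarMeasure]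

theorem lintegral_radialProfile_le (hφ : Differentiable ℝ φ)
    (hrad : ∀ x y, ‖x‖ = ‖y‖ → φ x = φ y) {e : E} (he : ‖e‖ = 1) (γ ρ : ℝ) :
    Module.finrank ℝ E * μ (Metric.ball 0 1) *
        ∫⁻ s in Ioo 0 ρ, ENNReal.ofReal (s ^ ((Module.finrank ℝ E - 1 : ℕ) : ℝ) *
          (deriv (fun r : ℝ => φ (r • e)) s ^ 2 + s ^ (-γ) * φ (s • e) ^ 2)) ≤
      ∫⁻ y in Metric.ball 0 ρ,
        (‖fderiv ℝ φ y‖ₑ ^ 2 + ENNReal.ofReal (‖y‖ ^ (-γ)) * ‖φ y‖ₑ ^ 2) ∂μ := by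
  have hprofile : Measurable fun r : ℝ => φ (r • e) := by
    have := hφ.continuous
    exact Continuous.measurable (by fun_prop)
  rw [setLIntegral_congr_fun measurableSet_Ioo fun s hs =>
      (by rw [Real.rpow_natCast, ENNReal.ofReal_mul (pow_nonneg hs.1.le _)]),
    ← setLIntegral_ball_fun_norm_addHaar μ (f := fun s => ENNReal.ofReal
      (deriv (fun r : ℝ => φ (r • e)) s ^ 2 + s ^ (-γ) * φ (s • e) ^ 2))
      (((measurable_deriv _).pow_const 2).add
        ((measurable_id.pow_const _).mul (hprofile.pow_const 2))).ennreal_ofReal]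
  refine lintegral_mono_ae ?_
  filter_upwards [ae_restrict_of_ae (μ.ae_ne 0)] with y hy
  have hderiv := abs_deriv_norm_le_norm_fderiv_of_radial hφ hrad he hy
  rw [apply_norm_smul_of_radial hrad he, ENNReal.ofReal_add (by positivity) (by positivity),
    ENNReal.ofReal_mul (by positivity), ← sq_abs, ← sq_abs (φ y), ← Real.norm_eq_abs (φ y),
    ENNReal.ofReal_pow (abs_nonneg _), ENNReal.ofReal_pow (norm_nonneg _), ofReal_norm]
  gcongr
  exact (ENNReal.ofReal_le_ofReal hderiv).trans_eq (ofReal_norm _)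

theorem exists_enorm_sq_le_of_radial {γ ρ : ℝ} (hγ : 2 ≤ γ) (hρ : ρ ≤ 1) :
    ∃ C : ℝ≥0, ∀ φ : E → ℝ, Differentiable ℝ φ → (∀ x y, ‖x‖ = ‖y‖ → φ x = φ y) →
      ∀ x ≠ 0, ‖x‖ < ρ / 2 →
        ENNReal.ofReal (‖x‖ ^ (2 * decayExponent (Module.finrank ℝ E) γ)) * ‖φ x‖ₑ ^ 2 ≤
          C * ∫⁻ y in Metric.ball 0 ρ,
            (‖fderiv ℝ φ y‖ₑ ^ 2 + ENNReal.ofReal (‖y‖ ^ (-γ)) * ‖φ y‖ₑ ^ 2) ∂μ := by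
  set ν : ℝ := ((Module.finrank ℝ E - 1 : ℕ) : ℝ)
  set m : ℝ≥0∞ := Module.finrank ℝ E * μ (Metric.ball 0 1)
  have hm0 : m ≠ 0 := mul_ne_zero (by exact_mod_cast Module.finrank_pos.ne')
    (Metric.measure_ball_pos μ 0 one_pos).ne'
  have hm : m ≠ ⊤ := ENNReal.mul_ne_top (ENNReal.natCast_ne_top _) measure_ball_lt_top.ne
  lift m⁻¹ to ℝ≥0 using ENNReal.inv_ne_top.2 hm0 with m' hm'
  refine ⟨(2 / ρ * (|ν - γ / 2| + 2)).toNNReal * m', fun φ hφ hrad x hx hxρ => ?_⟩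
  have he : ‖‖x‖⁻¹ • x‖ = 1 := by simp [norm_smul, hx]
  have hexp : 2 * decayExponent (Module.finrank ℝ E) γ = ν - γ / 2 := by
    have hν : ν = Module.finrank ℝ E - 1 := Nat.cast_pred Module.finrank_pos
    rw [decayExponent, hν]
    ring
  have htrace := ofReal_rpow_mul_sq_le_setLIntegral (ν := ν)
    (hφ.comp (differentiable_id.smul_const (‖x‖⁻¹ • x))) hγ hρ (norm_pos_iff.2 hx) hxρ
  simp only [Function.comp_def, id_eq, apply_norm_smul_of_radial hrad he] at htrace
  calc ENNReal.ofReal (‖x‖ ^ (2 * decayExponent (Module.finrank ℝ E) γ)) * ‖φ x‖ₑ ^ 2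
      = ENNReal.ofReal (‖x‖ ^ (ν - γ / 2) * φ x ^ 2) := by
        rw [hexp, ENNReal.ofReal_mul (by positivity), ← sq_abs (φ x), ← Real.norm_eq_abs,
          ENNReal.ofReal_pow (norm_nonneg _), ofReal_norm]
    _ ≤ _ := htrace
    _ ≤ ENNReal.ofReal (2 / ρ * (|ν - γ / 2| + 2)) * (m⁻¹ * ∫⁻ y in Metric.ball 0 ρ,
          (‖fderiv ℝ φ y‖ₑ ^ 2 + ENNReal.ofReal (‖y‖ ^ (-γ)) * ‖φ y‖ₑ ^ 2) ∂μ) := by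
        gcongr
        exact (ENNReal.mul_le_iff_le_inv hm0 hm).1 (lintegral_radialProfile_le μ hφ hrad he γ ρ)
    _ = _ := by rw [← hm', ENNReal.coe_mul, mul_assoc]; rfl

end Radial

section WeakGradient

variable {N : ℕ} {u w : Space N → ℝ} {g k : Space N → Space N}

theorem IsWeakGradient.sub (hu : IsWeakGradient u g) (hw : IsWeakGradient w k) :
    IsWeakGradient (u - w) (g - k) := by
  refine ⟨hu.1.sub hw.1, hu.2.1.sub hw.2.1, fun φ hφ hc v => ?_⟩
  have hφ' : Continuous fun x => fderiv ℝ φ x v :=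
    (hφ.continuous_fderiv (by simp)).clm_apply continuous_const
  have hc' : HasCompactSupport fun x => fderiv ℝ φ x v := hc.fderiv_apply ℝ v
  have hfderiv : ∀ {z : Space N → ℝ}, LocallyIntegrable z →
      Integrable fun x => z x * fderiv ℝ φ x v := fun hz => by
    simpa [mul_comm] using hz.integrable_smul_left_of_hasCompactSupport hφ' hc'
  have hinner : ∀ {z : Space N → Space N}, LocallyIntegrable z →
      Integrable fun x => φ x * inner ℝ (z x) v := fun hz => by
    simpa [inner_smul_left] using
      (hz.integrable_smul_left_of_hasCompactSupport hφ.continuous hc).inner_const (𝕜 := ℝ) v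
  simp only [Pi.sub_apply, sub_mul, inner_sub_left, mul_sub]
  rw [integral_sub (hfderiv hu.1) (hfderiv hw.1), integral_sub (hinner hu.2.1) (hinner hw.2.1),
    hu.2.2 φ hφ hc v, hw.2.2 φ hφ hc v]
  ring

theorem IsWeakGradient.ae_eq (hg : IsWeakGradient u g) (hk : IsWeakGradient u k) :
    g =ᵐ[volume] k := by
  refine ae_eq_of_integral_contDiff_smul_eq hg.2.1 hk.2.1 fun φ hφ hc => ?_
  refine ext_inner_left ℝ fun v => ?_
  rw [← integral_inner (hg.2.1.integrable_smul_left_of_hasCompactSupport hφ.continuous hc),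
    ← integral_inner (hk.2.1.integrable_smul_left_of_hasCompactSupport hφ.continuous hc)]
  have h := (hg.2.2 φ hφ hc v).symm.trans (hk.2.2 φ hφ hc v)
  simpa [inner_smul_right, real_inner_comm] using h

theorem IsWeakGradient.weakGradient_ae_eq (hg : IsWeakGradient u g) :
    weakGradient u =ᵐ[volume] g := by
  have h : ∃ g, IsWeakGradient u g := ⟨g, hg⟩
  rw [weakGradient, dif_pos h]
  exact h.choose_spec.ae_eq hg

theorem isWeakGradient_gradient {φ : Space N → ℝ} (hφ : ContDiff ℝ ∞ φ)
    (hc : HasCompactSupport φ) : IsWeakGradient φ (gradient φ) := by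
  have hd : Continuous (fderiv ℝ φ) := hφ.continuous_fderiv (by simp)
  have hgr : Continuous (gradient φ) :=
    (InnerProductSpace.toDual ℝ (Space N)).symm.continuous.comp hd
  refine ⟨hφ.continuous.locallyIntegrable, hgr.locallyIntegrable, fun ψ hψ hcψ v => ?_⟩
  have hdψ : Continuous (fderiv ℝ ψ) := hψ.continuous_fderiv (by simp)
  rw [integral_mul_fderiv_eq_neg_fderiv_mul_of_integrable]
  · congr 1
    refine integral_congr_ae (Eventually.of_forall fun x => ?_)
    simp [gradient, mul_comm]
  · exact ((hd.clm_apply continuous_const).mul hψ.continuous).integrable_of_hasCompactSupport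
      hcψ.mul_left
  · exact (hφ.continuous.mul (hdψ.clm_apply continuous_const)).integrable_of_hasCompactSupport
      hc.mul_right
  · exact (hφ.continuous.mul hψ.continuous).integrable_of_hasCompactSupport hc.mul_right
  · exact fun x _ => hφ.differentiable (by simp) x
  · exact fun x _ => hψ.differentiable (by simp) x

end WeakGradient

section Norm

variable {N : ℕ} {V : ℝ → ℝ≥0∞} {u w : Space N → ℝ} {g k : Space N → Space N}

theorem normHV_sq (V : ℝ → ℝ≥0∞) (u : Space N → ℝ) :
    normHV V u ^ 2 = ∫⁻ x, (‖weakGradient u x‖ₑ ^ 2 + V ‖x‖ * ‖u x‖ₑ ^ 2) := by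
  rw [normHV, ← ENNReal.rpow_mul_natCast]
  norm_num

theorem IsWeakGradient.normHV_sq (hg : IsWeakGradient u g) (V : ℝ → ℝ≥0∞) :
    normHV V u ^ 2 = ∫⁻ x, (‖g x‖ₑ ^ 2 + V ‖x‖ * ‖u x‖ₑ ^ 2) := by
  rw [RadialSobolev.normHV_sq]
  refine lintegral_congr_ae ?_
  filter_upwards [hg.weakGradient_ae_eq] with x hx
  rw [hx]

theorem lintegral_potential_le_normHV_sq (V : ℝ → ℝ≥0∞) (u : Space N → ℝ) :
    ∫⁻ x, V ‖x‖ * ‖u x‖ₑ ^ 2 ≤ normHV V u ^ 2 := by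
  rw [normHV_sq]
  exact lintegral_mono fun x => le_add_self

theorem enorm_sub_sq_le {E : Type*} [NormedAddCommGroup E] (a b : E) :
    ‖a - b‖ₑ ^ 2 ≤ 2 * ‖a‖ₑ ^ 2 + 2 * ‖b‖ₑ ^ 2 := by
  have h : ‖a - b‖₊ ^ 2 ≤ 2 * (‖a‖₊ ^ 2 + ‖b‖₊ ^ 2) :=
    (pow_le_pow_left₀ zero_le (nnnorm_sub_le a b) 2).trans add_sq_le
  rw [← mul_add]
  simp only [enorm_eq_nnnorm]
  exact_mod_cast h

theorem normHV_sq_of_contDiff {φ : Space N → ℝ} (hφ : ContDiff ℝ ∞ φ) (hc : HasCompactSupport φ)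
    (V : ℝ → ℝ≥0∞) :
    normHV V φ ^ 2 = ∫⁻ x, (‖fderiv ℝ φ x‖ₑ ^ 2 + V ‖x‖ * ‖φ x‖ₑ ^ 2) := by
  rw [(isWeakGradient_gradient hφ hc).normHV_sq]
  simp [gradient, enorm_eq_nnnorm]

variable [NeZero N]

theorem aemeasurable_comp_norm (hV : AEMeasurable V (volume.restrict (Ioi 0))) :
    AEMeasurable fun x : Space N => V ‖x‖ :=
  hV.comp_quasiMeasurePreserving (quasiMeasurePreserving_norm volume)

theorem IsWeakGradient.normHV_sub_sq_le (hu : IsWeakGradient u g) (hw : IsWeakGradient w k)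
    (hV : AEMeasurable V (volume.restrict (Ioi 0))) :
    normHV V (u - w) ^ 2 ≤ 2 * normHV V u ^ 2 + 2 * normHV V w ^ 2 := by
  have henergy : AEMeasurable fun x => ‖g x‖ₑ ^ 2 + V ‖x‖ * ‖u x‖ₑ ^ 2 :=
    (hu.2.1.aestronglyMeasurable.enorm.pow_const 2).add
      ((aemeasurable_comp_norm hV).mul (hu.1.aestronglyMeasurable.enorm.pow_const 2))
  rw [(hu.sub hw).normHV_sq, hu.normHV_sq, hw.normHV_sq, ← lintegral_const_mul' _ _ (by simp),
    ← lintegral_const_mul' _ _ (by simp), ← lintegral_add_left' (henergy.const_mul _)]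
  refine lintegral_mono fun x => ?_
  calc ‖(g - k) x‖ₑ ^ 2 + V ‖x‖ * ‖(u - w) x‖ₑ ^ 2
      ≤ (2 * ‖g x‖ₑ ^ 2 + 2 * ‖k x‖ₑ ^ 2) + V ‖x‖ * (2 * ‖u x‖ₑ ^ 2 + 2 * ‖w x‖ₑ ^ 2) := by
        gcongr <;> exact enorm_sub_sq_le _ _
    _ = _ := by ring

theorem setLIntegral_energy_le_normHV_sq {φ : Space N → ℝ} (hφ : ContDiff ℝ ∞ φ)
    (hφc : HasCompactSupport φ) {γ ρ : ℝ} {c : ℝ≥0} (hc : c ≠ 0)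
    (hV : ∀ᵐ r ∂volume.restrict (Ioo 0 ρ), c * ENNReal.ofReal (r ^ (-γ)) ≤ V r) :
    ∫⁻ y in Metric.ball 0 ρ,
      (‖fderiv ℝ φ y‖ₑ ^ 2 + ENNReal.ofReal (‖y‖ ^ (-γ)) * ‖φ y‖ₑ ^ 2) ≤
        (1 + c⁻¹ : ℝ≥0) * normHV V φ ^ 2 := by
  rw [normHV_sq_of_contDiff hφ hφc, ← lintegral_const_mul' _ _ ENNReal.coe_ne_top]
  refine (lintegral_mono_ae ?_).trans (setLIntegral_le_lintegral (Metric.ball 0 ρ) _)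
  filter_upwards [ae_restrict_ball_of_ae_restrict_Ioo volume hV] with y hy
  have hweight : ENNReal.ofReal (‖y‖ ^ (-γ)) ≤ (1 + c⁻¹ : ℝ≥0) * V ‖y‖ :=
    calc ENNReal.ofReal (‖y‖ ^ (-γ)) ≤ (c⁻¹ : ℝ≥0) * V ‖y‖ := by
          rw [ENNReal.coe_inv hc]
          exact (ENNReal.mul_le_iff_le_inv (by simpa using hc) ENNReal.coe_ne_top).1 hy
      _ ≤ _ := by gcongr; exact le_add_self
  rw [mul_add, ← mul_assoc]
  gcongr
  exact le_mul_of_one_le_left' (by simp)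

theorem exists_enorm_le_mul_normHV_of_smooth {γ ρ : ℝ} (hγ : 2 ≤ γ) (hρ : ρ ≤ 1) {c : ℝ≥0}
    (hc : c ≠ 0) (hV : ∀ᵐ r ∂volume.restrict (Ioo 0 ρ), c * ENNReal.ofReal (r ^ (-γ)) ≤ V r) :
    ∃ C : ℝ≥0, ∀ φ ∈ SmoothCompactRadial N, ∀ x ≠ 0, ‖x‖ < ρ / 2 →
      ‖φ x‖ₑ ≤ C * ENNReal.ofReal (‖x‖ ^ (-decayExponent N γ)) * normHV V φ := by
  obtain ⟨C, hC⟩ := exists_enorm_sq_le_of_radial (E := Space N) volume hγ hρ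
  rw [finrank_euclideanSpace_fin] at hC
  refine ⟨NNReal.sqrt (C * (1 + c⁻¹)), fun φ hφ x hx hxρ => ?_⟩
  have hsq : ENNReal.ofReal (‖x‖ ^ (2 * decayExponent N γ)) * ‖φ x‖ₑ ^ 2 ≤
      (C * (1 + c⁻¹) : ℝ≥0) * normHV V φ ^ 2 :=
    (hC φ (hφ.1.differentiable (by simp)) hφ.2.2 x hx hxρ).trans
      ((mul_le_mul_right (setLIntegral_energy_le_normHV_sq hφ.1 hφ.2.1 hc hV) _).trans_eq
        (by push_cast; ring))
  have hx0 : 0 < ‖x‖ := norm_pos_iff.2 hx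
  rw [← ENNReal.pow_le_pow_left_iff two_ne_zero]
  calc ‖φ x‖ₑ ^ 2 = ENNReal.ofReal (‖x‖ ^ (-(2 * decayExponent N γ))) *
        (ENNReal.ofReal (‖x‖ ^ (2 * decayExponent N γ)) * ‖φ x‖ₑ ^ 2) := by
        rw [← mul_assoc, ← ENNReal.ofReal_mul (by positivity), ← Real.rpow_add hx0]
        simp
    _ ≤ ENNReal.ofReal (‖x‖ ^ (-(2 * decayExponent N γ))) *
        ((C * (1 + c⁻¹) : ℝ≥0) * normHV V φ ^ 2) := by gcongr
    _ = _ := by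
        rw [mul_pow, mul_pow, ← ENNReal.coe_pow, NNReal.sq_sqrt,
          ← ENNReal.ofReal_pow (by positivity), ← Real.rpow_mul_natCast hx0.le]
        push_cast
        ring_nf

end Norm

theorem ae_enorm_le_of_forall_exists_lintegral_le {α F : Type*} [MeasurableSpace α]
    {μ : Measure α} [NormedAddCommGroup F] {u : α → F} {w b : α → ℝ≥0∞}
    (hu : AEStronglyMeasurable u μ) (hw : AEMeasurable w μ) (hb : AEMeasurable b μ)
    (hw0 : ∀ᵐ x ∂μ, w x ≠ 0)
    (happrox : ∀ ε : ℝ≥0∞, 0 < ε → ∃ φ : α → F,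
      (∀ᵐ x ∂μ, ‖φ x‖ₑ ≤ b x) ∧ ∫⁻ x, w x * ‖u x - φ x‖ₑ ^ 2 ∂μ ≤ ε) :
    ∀ᵐ x ∂μ, ‖u x‖ₑ ≤ b x := by
  have hzero : ∫⁻ x, w x * (‖u x‖ₑ - b x) ^ 2 ∂μ = 0 := by
    refine le_antisymm (ENNReal.le_of_forall_pos_le_add fun ε hε _ => ?_) zero_le
    obtain ⟨φ, hφ, hdist⟩ := happrox ε (by exact_mod_cast hε)
    rw [zero_add]
    refine le_trans (lintegral_mono_ae ?_) hdist
    filter_upwards [hφ] with x hx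
    gcongr
    calc ‖u x‖ₑ - b x ≤ ‖u x‖ₑ - ‖φ x‖ₑ := tsub_le_tsub_left hx _
      _ ≤ ‖u x - φ x‖ₑ := by
        rw [tsub_le_iff_right]
        simpa using enorm_add_le (u x - φ x) (φ x)
  have hae := (lintegral_eq_zero_iff' (f := fun x => w x * (‖u x‖ₑ - b x) ^ 2)
    (hw.mul ((hu.enorm.sub hb).pow_const 2))).1 hzero
  filter_upwards [hae, hw0] with x hx hwx
  simpa [hwx, tsub_eq_zero_iff_le] using hx

theorem mul_sq_rpow_half (v t : ℝ≥0∞) : (v * t ^ 2) ^ (1 / 2 : ℝ) = v ^ (1 / 2 : ℝ) * t := by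
  rw [ENNReal.mul_rpow_of_nonneg _ _ (by norm_num), ← ENNReal.rpow_natCast_mul]
  norm_num

theorem mul_rpow_sub_one (v t : ℝ≥0∞) {q : ℝ} (hq : 2 ≤ q) :
    v * t ^ (q - 1) = (v * t ^ 2) ^ (1 / 2 : ℝ) * v ^ (1 / 2 : ℝ) * t ^ (q - 2) := by
  have hhalf : (1 / 2 : ℝ) + 1 / 2 = 1 := add_halves 1
  rw [mul_sq_rpow_half, mul_right_comm (v ^ (1 / 2 : ℝ)),
    ← ENNReal.rpow_add_of_nonneg _ _ (by norm_num) (by norm_num), hhalf, ENNReal.rpow_one,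
    mul_assoc, show q - 1 = 1 + (q - 2) by ring,
    ENNReal.rpow_add_of_nonneg _ _ zero_le_one (by linarith), ENNReal.rpow_one]

section Estimates

variable {N : ℕ} [NeZero N] {V : ℝ → ℝ≥0∞} {K : ℝ → ℝ}

theorem exists_smooth_normHV_le_two (hV : AEMeasurable V (volume.restrict (Ioi 0)))
    {u : Space N → ℝ} (hu : u ∈ HVrad V) (hu1 : normHV V u ≤ 1) {ε : ℝ≥0∞} (hε : 0 < ε) :
    ∃ φ ∈ SmoothCompactRadial N, normHV V φ ≤ 2 ∧ ∫⁻ x, V ‖x‖ * ‖u x - φ x‖ₑ ^ 2 ≤ ε := by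
  obtain ⟨⟨⟨-, g, hg, -⟩, -⟩, happrox⟩ := hu
  obtain ⟨φ, hφ, -, hdist⟩ := happrox (min ε 1) (lt_min hε one_pos)
  refine ⟨φ, hφ, ?_, ?_⟩
  · rw [← ENNReal.pow_le_pow_left_iff two_ne_zero]
    calc normHV V φ ^ 2 = normHV V (u - (u - φ)) ^ 2 := by rw [sub_sub_cancel]
      _ ≤ 2 * normHV V u ^ 2 + 2 * normHV V (u - φ) ^ 2 :=
        hg.normHV_sub_sq_le (hg.sub (isWeakGradient_gradient hφ.1 hφ.2.1)) hV
      _ ≤ 2 * 1 ^ 2 + 2 * 1 ^ 2 := by gcongr; exact hdist.le.trans (min_le_right _ _)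
      _ = 2 ^ 2 := by norm_num
  · calc ∫⁻ x, V ‖x‖ * ‖(u - φ) x‖ₑ ^ 2
        ≤ normHV V (u - φ) ^ 2 := lintegral_potential_le_normHV_sq V _
      _ ≤ min ε 1 ^ 2 := by gcongr
      _ ≤ min ε 1 := pow_le_of_le_one zero_le (min_le_right _ _) two_ne_zero
      _ ≤ ε := min_le_left _ _

theorem exists_ae_enorm_le_of_mem_HVrad (hV : AEMeasurable V (volume.restrict (Ioi 0)))
    {γ ρ : ℝ} (hγ : 2 ≤ γ) (hρ : ρ ≤ 1) {c : ℝ≥0} (hc : c ≠ 0)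
    (hcV : ∀ᵐ r ∂volume.restrict (Ioo 0 ρ), c * ENNReal.ofReal (r ^ (-γ)) ≤ V r) :
    ∃ C : ℝ≥0, ∀ u : Space N → ℝ, u ∈ HVrad V → normHV V u ≤ 1 →
      ∀ᵐ x ∂volume.restrict (Metric.ball 0 (ρ / 2)),
        ‖u x‖ₑ ≤ C * ENNReal.ofReal (‖x‖ ^ (-decayExponent N γ)) := by
  obtain ⟨C, hC⟩ := exists_enorm_le_mul_normHV_of_smooth (N := N) hγ hρ hc hcV
  refine ⟨2 * C, fun u hu hu1 => ?_⟩
  refine ae_enorm_le_of_forall_exists_lintegral_le hu.1.1.1.1.restrict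
    (aemeasurable_comp_norm hV).restrict (by fun_prop) ?_ fun ε hε => ?_
  · rcases le_or_gt ρ 0 with hρ0 | hρ0
    · simp [Metric.ball_eq_empty.2 (show ρ / 2 ≤ 0 by linarith)]
    have hball := ae_mono (Measure.restrict_mono (Metric.ball_subset_ball (x := (0 : Space N))
      (half_le_self hρ0.le)) le_rfl) (ae_restrict_ball_of_ae_restrict_Ioo volume hcV)
    filter_upwards [hball, ae_restrict_ball_ne_zero_norm_lt volume _] with x hx hx0
    have := norm_pos_iff.2 hx0.1
    refine (lt_of_lt_of_le (ENNReal.mul_pos (by simpa using hc) ?_) hx).ne'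
    simpa using Real.rpow_pos_of_pos this _
  · obtain ⟨φ, hφ, hnorm, hdist⟩ := exists_smooth_normHV_le_two hV hu hu1 hε
    refine ⟨φ, ?_, (setLIntegral_le_lintegral _ _).trans hdist⟩
    filter_upwards [ae_restrict_ball_ne_zero_norm_lt volume _] with x hx
    calc ‖φ x‖ₑ ≤ C * ENNReal.ofReal (‖x‖ ^ (-decayExponent N γ)) * normHV V φ :=
          hC φ hφ x hx.1 hx.2
      _ ≤ C * ENNReal.ofReal (‖x‖ ^ (-decayExponent N γ)) * 2 := by gcongr
      _ = _ := by push_cast; ring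

theorem lintegral_rpow_mul_rpow_mul_rpow_le {α : Type*} [MeasurableSpace α] {μ : Measure α}
    {f g h : α → ℝ≥0∞} (hf : AEMeasurable f μ) (hg : AEMeasurable g μ) (hh : AEMeasurable h μ)
    {a b c : ℝ} (ha : 0 ≤ a) (hb : 0 ≤ b) (hc : 0 ≤ c) (habc : a + b + c = 1) :
    ∫⁻ x, f x ^ a * g x ^ b * h x ^ c ∂μ ≤
      (∫⁻ x, f x ∂μ) ^ a * (∫⁻ x, g x ∂μ) ^ b * (∫⁻ x, h x ∂μ) ^ c := by
  simpa [Fin.prod_univ_three] using ENNReal.lintegral_prod_norm_pow_le Finset.univ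
    (f := ![f, g, h]) (p := ![a, b, c]) (by simp [Fin.forall_fin_succ, hf, hg, hh])
    (by simpa [Fin.sum_univ_three] using habc) (by simp [Fin.forall_fin_succ, ha, hb, hc])

theorem R0_le_of_ae_le (hV : AEMeasurable V (volume.restrict (Ioi 0))) {q R a c : ℝ} (ha : 0 ≤ a)
    (hc : 0 ≤ c) (hac : a + 1 / 2 + c = 1) {G : Space N → ℝ≥0∞}
    (hG : AEMeasurable G (volume.restrict (Metric.ball 0 R))) {S : ℝ≥0}
    (hK : ∀ u : Space N → ℝ, u ∈ HVrad V → normHV V u = 1 →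
      ∀ᵐ x ∂volume.restrict (Metric.ball 0 R), ENNReal.ofReal (K ‖x‖) * ‖u x‖ₑ ^ (q - 1) ≤
        S * ((V ‖x‖ * ‖u x‖ₑ ^ 2) ^ a * V ‖x‖ ^ (1 / 2 : ℝ) * G x ^ c)) :
    R0 N V K q R ≤ S * (∫⁻ x in Metric.ball 0 R, G x) ^ c := by
  have hpotential : ∀ w : Space N → ℝ, normHV V w = 1 →
      ∫⁻ x in Metric.ball 0 R, V ‖x‖ * ‖w x‖ₑ ^ 2 ≤ 1 := fun w hw =>
    (setLIntegral_le_lintegral _ _).trans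
      ((lintegral_potential_le_normHV_sq V w).trans_eq (by simp [hw]))
  have hmeas : ∀ w ∈ HV (N := N) V, AEMeasurable (fun x => V ‖x‖ * ‖w x‖ₑ ^ 2)
      (volume.restrict (Metric.ball 0 R)) := fun w hw =>
    ((aemeasurable_comp_norm hV).mul (hw.1.1.1.enorm.pow_const 2)).restrict
  rw [R0]
  simp only [iSup_le_iff]
  intro u h hu hh hu1 hh1
  calc ∫⁻ x in Metric.ball 0 R, ENNReal.ofReal (K ‖x‖) * ‖u x‖ₑ ^ (q - 1) * ‖h x‖ₑ
      ≤ ∫⁻ x in Metric.ball 0 R, S * ((V ‖x‖ * ‖u x‖ₑ ^ 2) ^ a *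
          (V ‖x‖ * ‖h x‖ₑ ^ 2) ^ (1 / 2 : ℝ) * G x ^ c) := by
        refine lintegral_mono_ae ?_
        filter_upwards [hK u hu hu1] with x hx
        rw [mul_sq_rpow_half]
        exact (mul_le_mul_left hx _).trans_eq (by ring)
    _ = S * ∫⁻ x in Metric.ball 0 R, (V ‖x‖ * ‖u x‖ₑ ^ 2) ^ a *
          (V ‖x‖ * ‖h x‖ₑ ^ 2) ^ (1 / 2 : ℝ) * G x ^ c :=
        lintegral_const_mul' _ _ ENNReal.coe_ne_top
    _ ≤ S * ((∫⁻ x in Metric.ball 0 R, V ‖x‖ * ‖u x‖ₑ ^ 2) ^ a *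
          (∫⁻ x in Metric.ball 0 R, V ‖x‖ * ‖h x‖ₑ ^ 2) ^ (1 / 2 : ℝ) *
          (∫⁻ x in Metric.ball 0 R, G x) ^ c) := by
        gcongr
        exact lintegral_rpow_mul_rpow_mul_rpow_le (hmeas u hu.1) (hmeas h hh) hG ha
          (by norm_num) hc hac
    _ ≤ S * (1 ^ a * 1 ^ (1 / 2 : ℝ) * (∫⁻ x in Metric.ball 0 R, G x) ^ c) := by
        gcongr
        exacts [hpotential u hu1, hpotential h hh1]
    _ = _ := by simp

theorem R0_le_of_lt_two (hV : AEMeasurable V (volume.restrict (Ioi 0))) {q R a : ℝ}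
    (hq1 : 1 ≤ q) (hq2 : q < 2) {S : ℝ≥0}
    (hK : ∀ᵐ r ∂volume.restrict (Ioo 0 R),
      ENNReal.ofReal (K r) ≤ S * (ENNReal.ofReal (r ^ a) * V r ^ (q / 2))) :
    R0 N V K q R ≤ S * (∫⁻ x in Metric.ball (0 : Space N) R,
      ENNReal.ofReal (‖x‖ ^ (a / ((2 - q) / 2)))) ^ ((2 - q) / 2) := by
  refine R0_le_of_ae_le hV (a := (q - 1) / 2) (by linarith) (by linarith) (by ring)
    (by fun_prop) fun u _ _ => ?_
  filter_upwards [ae_restrict_ball_of_ae_restrict_Ioo volume hK] with x hx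
  have hweight : ENNReal.ofReal (‖x‖ ^ (a / ((2 - q) / 2))) ^ ((2 - q) / 2) =
      ENNReal.ofReal (‖x‖ ^ a) := by
    rw [ENNReal.ofReal_rpow_of_nonneg (by positivity) (by linarith),
      ← Real.rpow_mul (norm_nonneg x), div_mul_cancel₀ _ (by linarith)]
  have hpotential : (V ‖x‖ * ‖u x‖ₑ ^ 2) ^ ((q - 1) / 2) * V ‖x‖ ^ (1 / 2 : ℝ) =
      V ‖x‖ ^ (q / 2) * ‖u x‖ₑ ^ (q - 1) := by
    rw [ENNReal.mul_rpow_of_nonneg _ _ (by linarith), ← ENNReal.rpow_natCast_mul,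
      mul_right_comm, ← ENNReal.rpow_add_of_nonneg _ _ (by linarith) (by norm_num)]
    push_cast
    ring_nf
  rw [hweight, hpotential]
  exact (mul_le_mul_left hx _).trans_eq (by ring)

theorem R0_le_of_two_le (hV : AEMeasurable V (volume.restrict (Ioi 0))) {q R a δ : ℝ}
    (hq : 2 ≤ q) (ha : (q - 2) * δ ≤ a) {S C : ℝ≥0}
    (hK : ∀ᵐ r ∂volume.restrict (Ioo 0 R),
      ENNReal.ofReal (K r) ≤ S * (ENNReal.ofReal (r ^ a) * V r))
    (hdecay : ∀ u : Space N → ℝ, u ∈ HVrad V → normHV V u = 1 →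
      ∀ᵐ x ∂volume.restrict (Metric.ball 0 R), ‖u x‖ₑ ≤ C * ENNReal.ofReal (‖x‖ ^ (-δ))) :
    R0 N V K q R ≤ S * C ^ (q - 2) * ENNReal.ofReal (R ^ (a - (q - 2) * δ)) := by
  have hle := R0_le_of_ae_le hV (N := N) (K := K) (q := q) (R := R) (a := 1 / 2) (c := 0)
    (G := 1) (by norm_num) le_rfl (by norm_num) aemeasurable_const
    (S := S * C ^ (q - 2) * (R ^ (a - (q - 2) * δ)).toNNReal) fun u hu hu1 => ?_
  · simpa [ENNReal.coe_rpow_of_nonneg _ (sub_nonneg.2 hq), ENNReal.ofReal] using hle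
  filter_upwards [ae_restrict_ball_of_ae_restrict_Ioo volume hK, hdecay u hu hu1,
    ae_restrict_ball_ne_zero_norm_lt volume R] with x hx hux ⟨hx0, hxR⟩
  have hpower : ENNReal.ofReal (‖x‖ ^ a) * ‖u x‖ₑ ^ (q - 2) ≤
      C ^ (q - 2) * ENNReal.ofReal (R ^ (a - (q - 2) * δ)) :=
    calc ENNReal.ofReal (‖x‖ ^ a) * ‖u x‖ₑ ^ (q - 2)
        ≤ ENNReal.ofReal (‖x‖ ^ a) * (C * ENNReal.ofReal (‖x‖ ^ (-δ))) ^ (q - 2) := by gcongr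
      _ = C ^ (q - 2) * ENNReal.ofReal (‖x‖ ^ (a - (q - 2) * δ)) := by
        rw [ENNReal.mul_rpow_of_nonneg _ _ (by linarith),
          ENNReal.ofReal_rpow_of_nonneg (by positivity) (by linarith),
          ← Real.rpow_mul (norm_nonneg x), mul_left_comm, ← ENNReal.ofReal_mul (by positivity),
          ← Real.rpow_add (norm_pos_iff.2 hx0)]
        ring_nf
      _ ≤ _ := by gcongr
  calc ENNReal.ofReal (K ‖x‖) * ‖u x‖ₑ ^ (q - 1)
      ≤ S * (ENNReal.ofReal (‖x‖ ^ a) * V ‖x‖) * ‖u x‖ₑ ^ (q - 1) := by gcongr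
    _ = S * (ENNReal.ofReal (‖x‖ ^ a) * ‖u x‖ₑ ^ (q - 2)) *
        ((V ‖x‖ * ‖u x‖ₑ ^ 2) ^ (1 / 2 : ℝ) * V ‖x‖ ^ (1 / 2 : ℝ)) := by
        rw [← mul_assoc, mul_assoc, mul_rpow_sub_one _ _ hq]
        ring
    _ ≤ S * (C ^ (q - 2) * ENNReal.ofReal (R ^ (a - (q - 2) * δ))) *
        ((V ‖x‖ * ‖u x‖ₑ ^ 2) ^ (1 / 2 : ℝ) * V ‖x‖ ^ (1 / 2 : ℝ)) := by gcongr
    _ = _ := by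
        rw [ENNReal.rpow_zero, mul_one, ENNReal.coe_mul, ENNReal.coe_mul,
          ENNReal.coe_rpow_of_nonneg _ (sub_nonneg.2 hq), ENNReal.ofReal]
        ring

end Estimates

section Weights

variable {V : ℝ → ℝ≥0∞} {K : ℝ → ℝ} {R α β γ : ℝ}

theorem exists_ae_mul_rpow_neg_le
    (hinf : 0 < essInf (fun r : ℝ => ENNReal.ofReal (r ^ γ) * V r) (volume.restrict (Ioo 0 R))) :
    ∃ c : ℝ≥0, c ≠ 0 ∧ ∀ᵐ r ∂volume.restrict (Ioo 0 R), c * ENNReal.ofReal (r ^ (-γ)) ≤ V r := by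
  obtain ⟨c, hc, hcinf⟩ := ENNReal.lt_iff_exists_nnreal_btwn.1 hinf
  refine ⟨c, by simpa using hc.ne', ?_⟩
  filter_upwards [ae_lt_of_lt_essInf hcinf, ae_restrict_mem measurableSet_Ioo] with r hr hr0
  calc c * ENNReal.ofReal (r ^ (-γ))
      ≤ ENNReal.ofReal (r ^ γ) * V r * ENNReal.ofReal (r ^ (-γ)) := by gcongr
    _ = V r := by
      rw [mul_right_comm, ← ENNReal.ofReal_mul (Real.rpow_nonneg hr0.1.le _),
        ← Real.rpow_add hr0.1]
      simp

theorem le_mul_rpow_of_le {k W : ℝ≥0∞} {S c : ℝ≥0} {r θ : ℝ} (hS : S ≠ 0) (hc : c ≠ 0)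
    (hr : 0 < r) (hθ : 0 < θ) (hβ : β ≤ θ) (hk : k ≤ S * (ENNReal.ofReal (r ^ α) * W ^ β))
    (hW : c * ENNReal.ofReal (r ^ (-γ)) ≤ W) :
    k ≤ (S * c ^ (β - θ) : ℝ≥0) * (ENNReal.ofReal (r ^ (α + γ * (θ - β))) * W ^ θ) := by
  have hc' : (c : ℝ≥0∞) ≠ 0 := by exact_mod_cast hc
  have hpow (b : ℝ) : ENNReal.ofReal (r ^ b) ≠ 0 := by simpa using Real.rpow_pos_of_pos hr b
  rcases eq_or_ne W ⊤ with rfl | hWtop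
  · rw [ENNReal.top_rpow_of_pos hθ, ENNReal.mul_top (hpow _), ENNReal.mul_top]
    · exact le_top
    · simp [hS, hc, NNReal.rpow_eq_zero_iff]
  have hW0 : W ≠ 0 := ((ENNReal.mul_pos hc' (hpow _)).trans_le hW).ne'
  have hanti : W ^ (β - θ) ≤ (c * ENNReal.ofReal (r ^ (-γ))) ^ (β - θ) := by
    rw [← neg_sub, ENNReal.rpow_neg, ENNReal.rpow_neg, ENNReal.inv_le_inv]
    exact ENNReal.rpow_le_rpow hW (sub_nonneg.2 hβ)
  calc k ≤ S * (ENNReal.ofReal (r ^ α) * W ^ β) := hk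
    _ = S * (ENNReal.ofReal (r ^ α) * (W ^ (β - θ) * W ^ θ)) := by
      rw [← ENNReal.rpow_add _ _ hW0 hWtop, sub_add_cancel]
    _ ≤ S * (ENNReal.ofReal (r ^ α) * ((c * ENNReal.ofReal (r ^ (-γ))) ^ (β - θ) * W ^ θ)) := by
      gcongr
    _ = _ := by
      rw [ENNReal.mul_rpow_of_ne_top ENNReal.coe_ne_top ENNReal.ofReal_ne_top,
        ENNReal.ofReal_rpow_of_pos (by positivity), ← Real.rpow_mul hr.le, ENNReal.coe_mul,
        ENNReal.coe_rpow_of_ne_zero hc, show -γ * (β - θ) = γ * (θ - β) by ring,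
        Real.rpow_add hr, ENNReal.ofReal_mul (by positivity)]
      ring

theorem exists_ae_le_mul_rpow {c : ℝ≥0} {θ : ℝ} (hc : c ≠ 0)
    (hcV : ∀ᵐ r ∂volume.restrict (Ioo 0 R), c * ENNReal.ofReal (r ^ (-γ)) ≤ V r)
    (hsup : essSup (fun r : ℝ => ENNReal.ofReal (K r) / (ENNReal.ofReal (r ^ α) * V r ^ β))
      (volume.restrict (Ioo 0 R)) < ⊤) (hθ : 0 < θ) (hβ : β ≤ θ) :
    ∃ S : ℝ≥0, ∀ᵐ r ∂volume.restrict (Ioo 0 R),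
      ENNReal.ofReal (K r) ≤ S * (ENNReal.ofReal (r ^ (α + γ * (θ - β))) * V r ^ θ) := by
  obtain ⟨S, hSsup, -⟩ := ENNReal.lt_iff_exists_nnreal_btwn.1 hsup
  have hS : (S : ℝ≥0∞) ≠ 0 := (zero_le.trans_lt hSsup).ne'
  refine ⟨S * c ^ (β - θ), ?_⟩
  filter_upwards [ae_lt_of_essSup_lt hSsup, hcV, ae_restrict_mem measurableSet_Ioo]
    with r hK hV hr
  exact le_mul_rpow_of_le (by simpa using hS) hc hr.1 hθ hβ
    ((ENNReal.div_le_iff_le_mul (.inr ENNReal.coe_ne_top) (.inr hS)).1 hK.le) hV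

end Weights

section Region

variable {N : ℕ} {α β γ q : ℝ}

theorem max_one_two_mul_lt_of_mem_region (h : (α, q) ∈ region N β γ) : max 1 (2 * β) < q := by
  simp only [region, mem_ofPred_eq] at h
  split_ifs at h <;> simp only [max_lt_iff] at h ⊢ <;> tauto

theorem mul_sub_lt_of_mem_region (h : (α, q) ∈ region N β γ) :
    q * (N - γ) < 2 * (α - γ * β + N) := by
  simp only [region, mem_ofPred_eq, qStar, max_lt_iff, lt_min_iff, ← mul_div_assoc] at h
  have of_div_lt (hγ : (N : ℝ) < γ) (hq : 2 * (α - γ * β + N) / (N - γ) < q) :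
      q * (N - γ) < 2 * (α - γ * β + N) :=
    (div_lt_iff_of_neg (by linarith)).1 hq
  split_ifs at h with h₁ h₂
  · exact (lt_div_iff₀ (by linarith)).1 h.2.1
  · subst h₂
    linarith
  all_goals exact of_div_lt (lt_of_le_of_ne (not_lt.1 h₁) (Ne.symm h₂)) (by tauto)

theorem sub_two_mul_decayExponent_lt_of_mem_region (hN : 3 ≤ N) (h : (α, q) ∈ region N β γ) :
    (q - 2) * decayExponent N γ < α + γ * (1 - β) := by
  have hN' : (3 : ℝ) ≤ N := by exact_mod_cast hN
  simp only [region, mem_ofPred_eq, qStarStar, max_lt_iff, lt_min_iff, ← mul_div_assoc] at h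
  rw [decayExponent]
  have of_lt_div (hγ : γ < 2 * (N : ℝ) - 2) (hq : q <
      2 * (2 * α + (1 - 2 * β) * γ + 2 * ((N : ℝ) - 1)) / (2 * ((N : ℝ) - 1) - γ)) :
      (q - 2) * ((2 * ((N : ℝ) - 1) - γ) / 4) < α + γ * (1 - β) := by
    rw [lt_div_iff₀ (by linarith)] at hq
    linarith
  split_ifs at h with h₁ h₂ h₃ h₄
  · exact of_lt_div (by linarith) h.2.2
  · exact of_lt_div (by linarith) h.2.1
  · exact of_lt_div h₃ h.2
  · rw [h₄] at h ⊢
    linarith [h.2]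
  · have hγ : 2 * (N : ℝ) - 2 < γ := lt_of_le_of_ne (not_lt.1 h₃) (Ne.symm h₄)
    have := (div_lt_iff_of_neg (by linarith)).1 h.2
    linarith

end Region

section Limits

variable {N : ℕ} [NeZero N] {V : ℝ → ℝ≥0∞} {K : ℝ → ℝ} {α β γ q R₁ : ℝ} {c : ℝ≥0}

theorem tendsto_R0_of_lt_two (hV : AEMeasurable V (volume.restrict (Ioi 0)))
    (hR₁ : 0 < R₁) (hc : c ≠ 0)
    (hcV : ∀ᵐ r ∂volume.restrict (Ioo 0 R₁), c * ENNReal.ofReal (r ^ (-γ)) ≤ V r)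
    (hsup : essSup (fun r : ℝ => ENNReal.ofReal (K r) / (ENNReal.ofReal (r ^ α) * V r ^ β))
      (volume.restrict (Ioo 0 R₁)) < ⊤)
    (hq : (α, q) ∈ region N β γ) (hq2 : q < 2) :
    Tendsto (fun R : ℝ => R0 N V K q R) (𝓝[>] 0) (𝓝 0) := by
  obtain ⟨hq1, hqβ⟩ := max_lt_iff.1 (max_one_two_mul_lt_of_mem_region hq)
  obtain ⟨S, hS⟩ := exists_ae_le_mul_rpow (θ := q / 2) hc hcV hsup (by linarith) (by linarith)
  set a := α + γ * (q / 2 - β) with ha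
  have hexp : -(Module.finrank ℝ (Space N) : ℝ) < a / ((2 - q) / 2) := by
    have := mul_sub_lt_of_mem_region hq
    rw [finrank_euclideanSpace_fin, lt_div_iff₀ (by linarith), ha]
    linarith
  have hlim : Tendsto (fun R : ℝ => S * (∫⁻ x in Metric.ball (0 : Space N) R,
      ENNReal.ofReal (‖x‖ ^ (a / ((2 - q) / 2)))) ^ ((2 - q) / 2)) (𝓝[>] 0) (𝓝 0) := by
    have hrpow := (tendsto_setLIntegral_ball_rpow_norm volume hexp).ennrpow_const ((2 - q) / 2)
    simpa [ENNReal.zero_rpow_of_pos (show 0 < (2 - q) / 2 by linarith)] using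
      ENNReal.Tendsto.const_mul hrpow (.inr (ENNReal.coe_ne_top (r := S)))
  refine tendsto_of_tendsto_of_tendsto_of_le_of_le' tendsto_const_nhds hlim
    (.of_forall fun _ => zero_le) ?_
  filter_upwards [Ioo_mem_nhdsGT hR₁] with R hR
  exact R0_le_of_lt_two hV hq1.le hq2
    (ae_restrict_of_ae_restrict_of_subset (Ioo_subset_Ioo_right hR.2.le) hS)

theorem tendsto_R0_of_two_le (hN : 3 ≤ N) (hV : AEMeasurable V (volume.restrict (Ioi 0)))
    (hR₁ : 0 < R₁) (hβ : β ≤ 1) (hγ : 2 ≤ γ) (hc : c ≠ 0)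
    (hcV : ∀ᵐ r ∂volume.restrict (Ioo 0 R₁), c * ENNReal.ofReal (r ^ (-γ)) ≤ V r)
    (hsup : essSup (fun r : ℝ => ENNReal.ofReal (K r) / (ENNReal.ofReal (r ^ α) * V r ^ β))
      (volume.restrict (Ioo 0 R₁)) < ⊤)
    (hq : (α, q) ∈ region N β γ) (hq2 : 2 ≤ q) :
    Tendsto (fun R : ℝ => R0 N V K q R) (𝓝[>] 0) (𝓝 0) := by
  obtain ⟨S, hS⟩ := exists_ae_le_mul_rpow hc hcV hsup one_pos hβ
  simp only [ENNReal.rpow_one] at hS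
  set ρ := min R₁ 1
  have hρR₁ : ρ ≤ R₁ := min_le_left _ _
  have hρ0 : 0 < ρ := lt_min hR₁ one_pos
  obtain ⟨C, hC⟩ := exists_ae_enorm_le_of_mem_HVrad (N := N) hV hγ (min_le_right _ _) hc
    (ae_restrict_of_ae_restrict_of_subset (Ioo_subset_Ioo_right hρR₁) hcV)
  set δ := decayExponent N γ
  set a := α + γ * (1 - β)
  have hexp : (q - 2) * δ < a := sub_two_mul_decayExponent_lt_of_mem_region hN hq
  have hlim : Tendsto (fun R : ℝ => S * C ^ (q - 2) *
      ENNReal.ofReal (R ^ (a - (q - 2) * δ))) (𝓝[>] 0) (𝓝 0) := by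
    have hrpow := ENNReal.tendsto_ofReal ((Real.continuousAt_rpow_const 0 (a - (q - 2) * δ)
      (.inr (sub_nonneg.2 hexp.le))).tendsto.mono_left (nhdsWithin_le_nhds (s := Ioi 0)))
    rw [Real.zero_rpow (sub_pos.2 hexp).ne', ENNReal.ofReal_zero] at hrpow
    simpa using ENNReal.Tendsto.const_mul hrpow (.inr (ENNReal.mul_ne_top
      (ENNReal.coe_ne_top (r := S)) (ENNReal.rpow_ne_top_of_nonneg (sub_nonneg.2 hq2)
        (ENNReal.coe_ne_top (r := C)))))
  refine tendsto_of_tendsto_of_tendsto_of_le_of_le' tendsto_const_nhds hlim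
    (.of_forall fun _ => zero_le) ?_
  filter_upwards [Ioo_mem_nhdsGT (half_pos hρ0)] with R hR
  refine R0_le_of_two_le hV hq2 hexp.le (ae_restrict_of_ae_restrict_of_subset
    (Ioo_subset_Ioo_right (by linarith [hR.2])) hS) fun u hu hu1 => ?_
  exact ae_restrict_of_ae_restrict_of_subset (Metric.ball_subset_ball hR.2.le) (hC u hu hu1.le)

end Limits

end RadialSobolev

theorem theorem2p7_general (N : ℕ) (hN : 3 ≤ N) (V : ℝ → ℝ≥0∞) (K : ℝ → ℝ)
    (hV : AEMeasurable V (volume.restrict (Ioi 0)))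
    (R₁ : ℝ) (hR₁ : 0 < R₁)
    (α₀ β₀ γ₀ : ℝ) (hβ₁ : β₀ ≤ 1) (hγ₀ : 2 ≤ γ₀)
    (hsup : essSup (fun r : ℝ => ENNReal.ofReal (K r) / (ENNReal.ofReal (r ^ α₀) * V r ^ β₀))
      (volume.restrict (Ioo 0 R₁)) < ⊤)
    (hinf : 0 < essInf (fun r : ℝ => ENNReal.ofReal (r ^ γ₀) * V r)
      (volume.restrict (Ioo 0 R₁)))
    (q₁ : ℝ) (hq₁ : (α₀, q₁) ∈ RadialSobolev.region N β₀ γ₀) :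
    Tendsto (fun R : ℝ => RadialSobolev.R0 N V K q₁ R) (𝓝[>] 0) (𝓝 0) := by
  have : NeZero N := ⟨by omega⟩
  obtain ⟨c, hc, hcV⟩ := RadialSobolev.exists_ae_mul_rpow_neg_le hinf
  rcases lt_or_ge q₁ 2 with hq2 | hq2
  · exact RadialSobolev.tendsto_R0_of_lt_two hV hR₁ hc hcV hsup hq₁ hq2
  · exact RadialSobolev.tendsto_R0_of_two_le hN hV hR₁ hβ₁ hγ₀ hc hcV hsup hq₁ hq2

theorem theorem2p7 (N : ℕ) (hN : 3 ≤ N) (V : ℝ → ℝ≥0∞) (K : ℝ → ℝ)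
    (hV : RadialSobolev.AssumptionV V) (hK : RadialSobolev.AssumptionK N K)
    (hVfin : ∀ᵐ r ∂(volume.restrict (Ioi (0 : ℝ))), V r < ⊤)
    (R₁ : ℝ) (hR₁ : 0 < R₁)
    (α₀ β₀ γ₀ : ℝ) (hβ₀ : 0 ≤ β₀) (hβ₁ : β₀ ≤ 1) (hγ₀ : 2 ≤ γ₀)
    (hsup : essSup (fun r : ℝ => ENNReal.ofReal (K r) / (ENNReal.ofReal (r ^ α₀) * V r ^ β₀))
      (volume.restrict (Ioo 0 R₁)) < ⊤)
    (hinf : 0 < essInf (fun r : ℝ => ENNReal.ofReal (r ^ γ₀) * V r)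
      (volume.restrict (Ioo 0 R₁)))
    (q₁ : ℝ) (hq₁ : (α₀, q₁) ∈ RadialSobolev.region N β₀ γ₀) :
    Tendsto (fun R : ℝ => RadialSobolev.R0 N V K q₁ R) (𝓝[>] 0) (𝓝 0) :=
  theorem2p7_general N hN V K hV.1 R₁ hR₁ α₀ β₀ γ₀ hβ₁ hγ₀ hsup hinf q₁ hq₁
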